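/- Let $n$ points be given in $\mathbb{R}^d$. Sort the $\binom n2$ edges (pairs of points) by Euclidean length; the entry time of a triangle (triple of points) is the index of its last edge in this order, and the $\binom n3$ triangles are sorted by entry time. Ties are broken arbitrarily. The degree-$1$ boundary matrix $D$ is the $\binom n2\times\binom n3$ matrix over $\mathbb{Z}_2$, with rows and columns in these orders, whose entry $(i,j)$ is $1$ iff the $i$-th edge is contained in the $j$-th triangle. The pivot of a non-zero column is its largest row index with a non-zero entry. Matrix reduction traverses the columns from left to right; at column $i$, as long as this column is non-zero and some current column $j<i$ has the same pivot, it adds column $j$ to column $i$. Write $D'$ for the resulting reduced matrix, $\#D'$ (the fill-up) for its number of non-zero entries, and $\mathrm{cost}(D)$ for the sum, over all column additions performed, of the number of non-zero entries of the column that is added. **Theorem.** There is an absolute constant $c>0$ such that the following hold. 1. (Lower bound.) For every $n$ and arbitrary orders of the edges and of the triangles on $n$ vertices, $\#D'\ge\binom n2-n$, and $\#D'\ge c\,n^2$ if $n\ge 3$. 2. (Vietoris--Rips model.) For every $d\ge 1$ there is a constant $C>0$, depending only on $d$, such that for every $n$, if the $n$ points are independent and uniformly distributed in $[0,1]^d$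 (and the ties are broken by any measurable, possibly random, rule), then $$\mathbb{E}[\#D']\le C\,n^2\log^2 n,\qquad \mathbb{E}[\mathrm{cost}(D)]\le C\,n^5\log^2 n,$$ and $\mathbb{E}[\#D']\ge c\,n^2$ if $n\ge 3$. In particular, the fill-up bound is tight up to a factor $\log^2 n$. -/

import Mathlib

open MeasureTheory ProbabilityTheory

/-! ### Matrix reduction over the field with two elements -/

section Reduction

variable {r c : ℕ}

/-- The number of non-zero entries of a column. -/
def colCount (v : Fin r → ZMod 2) : ℕ :=
  (Finset.univ.filter fun i => v i ≠ 0).card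

/-- The number of non-zero entries of a matrix, counted column by column. -/
def matCount (M : Matrix (Fin r) (Fin c) (ZMod 2)) : ℕ :=
  ∑ j, colCount (M.col j)

/-- The pivot of a column: the largest (that is, lowest in the matrix) row index carrying a
non-zero entry; it is `⊥` exactly for the zero column. -/
def pivot (v : Fin r → ZMod 2) : WithBot (Fin r) :=
  (Finset.univ.filter fun i => v i ≠ 0).max

/-- Adding a column with the same pivot strictly decreases the pivot: the `while` loop
terminates. -/
theorem pivot_add_lt {v w : Fin r → ZMod 2} (hv : v ≠ 0) (h : pivot w = pivot v) :
    pivot (v + w) < pivot v := by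
  have key : ∀ u : Fin r → ZMod 2, ∀ p : Fin r, pivot u = p → u p = 1 := by
    intro u p hp
    have h1 := Finset.mem_of_max hp
    simp only [Finset.mem_filter, Finset.mem_univ, true_and] at h1
    revert h1
    generalize u p = a
    revert a
    decide
  have hne : (Finset.univ.filter fun i => v i ≠ 0).Nonempty := by
    obtain ⟨i, hi⟩ := Function.ne_iff.mp hv
    exact ⟨i, by simpa using hi⟩
  obtain ⟨p, hp⟩ := Finset.max_of_nonempty hne
  have hvp : pivot v = p := hp
  have hwp : pivot w = p := h.trans hvp
  rw [hvp]
  unfold pivot Finset.max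
  refine (Finset.sup_lt_iff (WithBot.bot_lt_coe p)).mpr ?_
  intro i hi
  simp only [Finset.mem_filter, Finset.mem_univ, true_and] at hi
  by_contra hlt
  have hpi : p ≤ i := by simpa using hlt
  rcases hpi.eq_or_lt with rfl | hpi
  · apply hi
    rw [Pi.add_apply, key v p hvp, key w p hwp]
    decide
  · have hz : ∀ u : Fin r → ZMod 2, pivot u = p → u i = 0 := by
      intro u hu
      by_contra hui
      have h2 : (i : WithBot (Fin r)) ≤ pivot u := Finset.le_max (by simpa using hui)
      rw [hu] at h2
      exact absurd (WithBot.coe_le_coe.mp h2) (not_le.mpr hpi)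
    apply hi
    rw [Pi.add_apply, hz v hvp, hz w hwp, add_zero]

/-- The inner `while` loop on column `i`, with current value `v` of that column and current
matrix `N`: as long as `v ≠ 0` and some column `j < i` of `N` has the same pivot as `v`, add that
column to `v`. Returns the final column and the cost of the additions performed, where adding a
column costs the number of its non-zero entries. -/
def reduceColumn (N : Matrix (Fin r) (Fin c) (ZMod 2)) (i : Fin c) (v : Fin r → ZMod 2) :
    (Fin r → ZMod 2) × ℕ :=
  if hv : v = 0 then (v, 0)
  else
    match hj : (List.finRange c).find? (fun j => j < i ∧ pivot (N.col j) = pivot v) with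
    | none => (v, 0)
    | some j =>
      let q := reduceColumn N i (v + N.col j)
      (q.1, colCount (N.col j) + q.2)
  termination_by wellFounded_lt.wrap (pivot v)
  decreasing_by
    have h := List.find?_some hj
    simp only [decide_eq_true_eq] at h
    exact pivot_add_lt hv h.2

/-- Matrix reduction: traverse the columns from left to right and reduce each of them. Returns
the reduced matrix and the total cost of all column additions. -/
def matrixReduction (M : Matrix (Fin r) (Fin c) (ZMod 2)) :
    Matrix (Fin r) (Fin c) (ZMod 2) × ℕ :=
  (List.finRange c).foldl
    (fun S i =>
      let q := reduceColumn S.1 i (S.1.col i)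
      (S.1.updateCol i q.1, S.2 + q.2))
    (M, 0)

/-- The fill-up: the number of non-zero entries of the reduced matrix. -/
def fillUp (M : Matrix (Fin r) (Fin c) (ZMod 2)) : ℕ :=
  matCount (matrixReduction M).1

/-- The cost of the matrix reduction. -/
def reductionCost (M : Matrix (Fin r) (Fin c) (ZMod 2)) : ℕ :=
  (matrixReduction M).2

end Reduction

/-! ### Clique filtrations on the complete complex with `n` vertices -/

/-- The `k`-simplices of the complete complex over `n` vertices. -/
abbrev Simplex (n k : ℕ) : Type := {s : Finset (Fin n) // s.card = k + 1}

/-- A total order on the `k`-simplices, as an enumeration; there are `n.choose (k + 1)` many. -/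
abbrev SimplexOrder (n k : ℕ) : Type := Fin (n.choose (k + 1)) ≃ Simplex n k

/-- The boundary matrix in dimension `k`: rows are the ordered `k`-simplices, columns the ordered
`(k + 1)`-simplices, and an entry is `1` iff the row simplex is a facet of the column simplex. -/
def boundaryMatrix {n k : ℕ} (σ : SimplexOrder n k) (τ : SimplexOrder n (k + 1)) :
    Matrix (Fin (n.choose (k + 1))) (Fin (n.choose (k + 1 + 1))) (ZMod 2) :=
  Matrix.of fun i j => if (σ i).1 ⊆ (τ j).1 then 1 else 0

/-- The `k`-clique complex `K_i`: the largest simplicial complex on the vertex set `Fin n` whose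
`k`-simplices are exactly the first `i` ones of the order `σ`, that is, all simplices each of whose
`k`-dimensional faces is one of the first `i` ones. -/
def cliqueComplex {n k : ℕ} (σ : SimplexOrder n k) (i : ℕ) : Set (Finset (Fin n)) :=
  {s | s.Nonempty ∧ ∀ e : Simplex n k, e.1 ⊆ s → (σ.symm e : ℕ) < i}

/-- The entry time of a simplex: the smallest `i` such that it belongs to `K_i`. -/
noncomputable def entryTime {n k : ℕ} (σ : SimplexOrder n k) (s : Finset (Fin n)) : ℕ :=
  sInf {i | s ∈ cliqueComplex σ i}

/-- The order `τ` of the `(k + 1)`-simplices respects the `k`-clique filtration given by `σ`: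
they are sorted by entry time, with ties broken arbitrarily. -/
def RespectsCliqueFiltration {n k : ℕ} (σ : SimplexOrder n k) (τ : SimplexOrder n (k + 1)) :
    Prop :=
  Monotone fun j => entryTime σ (τ j).1

/-! ### The Vietoris–Rips filtration model -/

/-- The unit cube `[0,1]^d`. -/
def unitCube (d : ℕ) : Set (EuclideanSpace ℝ (Fin d)) :=
  {x | ∀ i, x i ∈ Set.Icc (0 : ℝ) 1}

/-- The Euclidean length of an edge, for vertices placed at the points `x`. -/
noncomputable def edgeLength {n d : ℕ} (x : Fin n → EuclideanSpace ℝ (Fin d))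
    (e : Simplex n 1) : ℝ :=
  Metric.diam (x '' (e.1 : Set (Fin n)))

/-- The edges are sorted by length (ties broken arbitrarily), and the triangles are sorted
according to the resulting clique filtration. -/
structure IsVietorisRipsOrder {n d : ℕ} (x : Fin n → EuclideanSpace ℝ (Fin d))
    (σ : SimplexOrder n 1) (τ : SimplexOrder n 2) : Prop where
  sorted : Monotone fun i => edgeLength x (σ i)
  respects : RespectsCliqueFiltration σ τ

/-- The Vietoris–Rips filtration model: `X` consists of `n` independent points, uniformly
distributed in `[0,1]^d`, and the random orders `σ` of the edges and `τ` of the triangles almost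
surely form the Vietoris–Rips filtration of these points (ties being broken by any measurable
rule, possibly a random one). -/
structure IsVietorisRipsModel {n d : ℕ} {Ω : Type*} [MeasurableSpace Ω] (μ : Measure Ω)
    (X : Fin n → Ω → EuclideanSpace ℝ (Fin d))
    (σ : Ω → SimplexOrder n 1) (τ : Ω → SimplexOrder n 2) : Prop where
  measurable_point : ∀ a, Measurable (X a)
  indep : iIndepFun X μ
  uniform : ∀ a, pdf.IsUniform (X a) (unitCube d) μ volume
  measurable_edgeOrder : Measurable[_, ⊤] σ
  measurable_triangleOrder : Measurable[_, ⊤] τ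
  filtration : ∀ᵐ ω ∂μ, IsVietorisRipsOrder (fun a => X a ω) (σ ω) (τ ω)

/-!
Write `N = n.choose 2` for the number of edges.

The whole theorem is about the non-zero columns of the reduced matrix. Their pivots are pairwise
distinct, so these columns can be indexed by rows, and the column with pivot `i` has at most
`i + 1` entries (`fillUp_le_sum`). Reduction preserves the column span, so their number is at least
the rank of the boundary matrix; the triangles containing a fixed vertex are linearly independent,
which gives the lower bound `(n - 1).choose 2` (`choose_le_fillUp`). Reducing one column never adds
the same column twice, because the pivot strictly decreases; the cost of one column is thus at most
the fill-up, and the total cost is at most `n ^ 3` times the fill-up (`reductionCost_le`).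

For the upper bound, call an edge apparent if it is the last edge of some triangle. The first
such triangle has an unreduced column with the edge as its pivot, and no earlier column reaches
that row, so the reduction leaves this column, which has three entries, unchanged
(`colCount_le_of_apparent`). Only non-apparent edges can carry long columns. For points in
Euclidean space, an edge `ab` is apparent as soon as a third point lies in the open ball
with `a` and `b` as antipodal points, and at least a constant times `r ^ d` of the cube lies in
this ball when `ab` has length `r` (`le_uniformCube_ball`). Choose the threshold `R` with
`R ^ d` of order `log n / n`. With probability `1 - O(n ^ (-2))` every edge longer than `R` is
apparent; then each long column sits in a row of an edge of length at most `R` and has entries only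
in such rows, so the fill-up is at most `3 * N + S ^ 2`, where `S` is the number of edges of
length at most `R` (`IsVietorisRipsOrder.fillUp_le`). Two different edges are both that short with
probability `O(R ^ (2 * d))`, so the expectation of `S ^ 2` is `O(n ^ 2 * log n ^ 2)`
(`lintegral_card_shortEdges_sq_le`). In the exceptional event the bound `N ^ 2` on the
fill-up costs another `O(n ^ 2)`. All probabilities are computed by integrating out one point at a
time (`measure_pi_inter_le`).
-/

/-! ### Invariants of the matrix reduction -/

section ReductionLemmas

variable {r c : ℕ}

theorem pivot_eq_bot {v : Fin r → ZMod 2} : pivot v = ⊥ ↔ v = 0 := by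
  simp [pivot, Finset.max_eq_bot, Finset.filter_eq_empty_iff, funext_iff]

theorem pivot_zero : pivot (0 : Fin r → ZMod 2) = ⊥ := pivot_eq_bot.2 rfl

theorem le_pivot {v : Fin r → ZMod 2} {i : Fin r} (h : v i ≠ 0) : (i : WithBot (Fin r)) ≤ pivot v :=
  Finset.le_max (by simpa using h)

theorem pivot_lt_coe {v : Fin r → ZMod 2} {i : Fin r} (h : ∀ k, v k ≠ 0 → k < i) :
    pivot v < i := by
  unfold pivot Finset.max
  refine (Finset.sup_lt_iff (WithBot.bot_lt_coe i)).mpr fun k hk => ?_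
  exact WithBot.coe_lt_coe.2 (h k (by simpa using hk))

theorem pivot_eq_coe {v : Fin r → ZMod 2} {i : Fin r} (hi : v i ≠ 0) (h : ∀ k, v k ≠ 0 → k ≤ i) :
    pivot v = i :=
  le_antisymm (Finset.max_le fun k hk => WithBot.coe_le_coe.2 (h k (by simpa using hk)))
    (le_pivot hi)

theorem colCount_zero : colCount (0 : Fin r → ZMod 2) = 0 := by
  simp [colCount]

theorem one_le_colCount {v : Fin r → ZMod 2} (hv : v ≠ 0) : 1 ≤ colCount v := by
  obtain ⟨i, hi⟩ := Function.ne_iff.mp hv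
  exact Finset.card_pos.2 ⟨i, by simpa using hi⟩

theorem colCount_le_of_pivot {v : Fin r → ZMod 2} {i : Fin r} (h : pivot v = i) :
    colCount v ≤ i + 1 := by
  have hsub : (Finset.univ.filter fun k => v k ≠ 0) ⊆ Finset.Iic i := by
    intro k hk
    have h2 := le_pivot (by simpa using hk : v k ≠ 0)
    rw [h] at h2
    simpa using h2
  calc colCount v ≤ (Finset.Iic i).card := Finset.card_le_card hsub
    _ = i + 1 := by simp

theorem reduceColumn_zero (N : Matrix (Fin r) (Fin c) (ZMod 2)) (i : Fin c) :
    reduceColumn N i 0 = (0, 0) := by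
  rw [reduceColumn]; simp

theorem reduceColumn_of_forall_ne {N : Matrix (Fin r) (Fin c) (ZMod 2)} {i : Fin c}
    {v : Fin r → ZMod 2} (h : ∀ j < i, pivot (N.col j) ≠ pivot v) :
    reduceColumn N i v = (v, 0) := by
  rw [reduceColumn]
  split
  · rfl
  · split
    · rfl
    · rename_i j hj
      have h1 := List.find?_some hj
      simp only [decide_eq_true_eq] at h1
      exact absurd h1.2 (h j h1.1)

/-- One round of the `while` loop is the induction step; this is the only place where its control
flow matters. -/
theorem reduceColumn_induction (N : Matrix (Fin r) (Fin c) (ZMod 2)) (i : Fin c)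
    {P : (Fin r → ZMod 2) → (Fin r → ZMod 2) × ℕ → Prop}
    (hzero : P 0 (0, 0))
    (hdone : ∀ v, v ≠ 0 → (∀ j < i, pivot (N.col j) ≠ pivot v) → P v (v, 0))
    (hadd : ∀ v j, v ≠ 0 → j < i → pivot (N.col j) = pivot v → ∀ q, P (v + N.col j) q →
      P v (q.1, colCount (N.col j) + q.2)) (v : Fin r → ZMod 2) :
    P v (reduceColumn N i v) := by
  induction hp : pivot v using WellFoundedLT.induction generalizing v with
  | _ p ih =>
    by_cases hv : v = 0
    · subst hv
      rwa [reduceColumn_zero]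
    · rw [reduceColumn, dif_neg hv]
      split
      · rename_i hj
        refine hdone v hv fun j hji hpj => ?_
        have := List.find?_eq_none.1 hj j (List.mem_finRange j)
        simp [hji, hpj] at this
      · rename_i j hj
        have h1 := List.find?_some hj
        simp only [decide_eq_true_eq] at h1
        exact hadd v j hv h1.1 h1.2 _ (ih _ (hp ▸ pivot_add_lt hv h1.2) _ rfl)

theorem reduceColumn_pivot_ne (N : Matrix (Fin r) (Fin c) (ZMod 2)) (i : Fin c)
    (v : Fin r → ZMod 2) : (reduceColumn N i v).1 = 0 ∨
      ∀ j < i, pivot (N.col j) ≠ pivot (reduceColumn N i v).1 := by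
  refine reduceColumn_induction N i (P := fun _ q => q.1 = 0 ∨ ∀ j < i, pivot (N.col j) ≠ pivot q.1)
    (Or.inl rfl) (fun v _ h => Or.inr h) (fun v j _ _ _ q hq => hq) v

theorem pivot_reduceColumn_le (N : Matrix (Fin r) (Fin c) (ZMod 2)) (i : Fin c)
    (v : Fin r → ZMod 2) : pivot (reduceColumn N i v).1 ≤ pivot v := by
  refine reduceColumn_induction N i (P := fun v q => pivot q.1 ≤ pivot v)
    le_rfl (fun v _ _ => le_rfl) (fun v j hv _ hj q hq => hq.trans (pivot_add_lt hv hj).le) v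

theorem reduceColumn_mem_span (N : Matrix (Fin r) (Fin c) (ZMod 2)) (i : Fin c)
    (v : Fin r → ZMod 2) :
    (reduceColumn N i v).1 - v ∈ Submodule.span (ZMod 2) (N.col '' Set.Iio i) := by
  refine reduceColumn_induction N i
    (P := fun v q => q.1 - v ∈ Submodule.span (ZMod 2) (N.col '' Set.Iio i))
    (by simp) (fun v _ _ => by simp) (fun v j hv hji hj q hq => ?_) v
  have h : q.1 - v = (q.1 - (v + N.col j)) + N.col j := by abel
  rw [h]
  exact Submodule.add_mem _ hq (Submodule.subset_span ⟨j, hji, rfl⟩)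

/-- Within one `while` loop the pivot strictly decreases, so no column is added twice. -/
theorem reduceColumn_cost_le (N : Matrix (Fin r) (Fin c) (ZMod 2)) (i : Fin c)
    (v : Fin r → ZMod 2) :
    (reduceColumn N i v).2 ≤
      ∑ j ∈ Finset.Iio i with pivot (N.col j) ≤ pivot v, colCount (N.col j) := by
  refine reduceColumn_induction N i
    (P := fun v q => q.2 ≤ ∑ j ∈ Finset.Iio i with pivot (N.col j) ≤ pivot v, colCount (N.col j))
    (Nat.zero_le _) (fun v _ _ => Nat.zero_le _) (fun v j hv hji hj q hq => ?_) v
  have hlt := pivot_add_lt hv hj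
  have hnot : j ∉ Finset.filter (fun k => pivot (N.col k) ≤ pivot (v + N.col j))
      (Finset.Iio i) := by
    simp [hj, hlt]
  refine (Nat.add_le_add_left hq _).trans ?_
  rw [← Finset.sum_insert (f := fun k => colCount (N.col k)) hnot]
  refine Finset.sum_le_sum_of_subset fun k hk => ?_
  simp only [Finset.mem_insert, Finset.mem_filter, Finset.mem_Iio] at hk ⊢
  rcases hk with rfl | hk
  · exact ⟨hji, hj.le⟩
  · exact ⟨hk.1, hk.2.trans hlt.le⟩

theorem foldl_finRange_induction {S : Type*} (f : S → Fin c → S) (s₀ : S) {P : ℕ → S → Prop}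
    (h0 : P 0 s₀) (hstep : ∀ (i : Fin c) s, P i s → P (i + 1) (f s i)) :
    P c ((List.finRange c).foldl f s₀) := by
  have key : ∀ k ≤ c, P k (((List.finRange c).take k).foldl f s₀) := by
    intro k
    induction k with
    | zero => intro _; simpa using h0
    | succ k ih =>
      intro hk
      have hlen : k < (List.finRange c).length := by simpa using hk
      rw [List.take_succ_eq_append_getElem hlen, List.foldl_append]
      simpa using hstep ⟨k, hk⟩ _ (ih (by omega))
  simpa [List.take_of_length_le] using key c le_rfl

/-- What holds when the first `k` columns of `M` have been reduced, the current matrix being `N`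
and the cost so far being `cost`. -/
structure IsReducedUpTo (M : Matrix (Fin r) (Fin c) (ZMod 2)) (k : ℕ)
    (N : Matrix (Fin r) (Fin c) (ZMod 2)) (cost : ℕ) : Prop where
  col_eq : ∀ j : Fin c, k ≤ j → N.col j = M.col j
  pivot_le : ∀ j : Fin c, (j : ℕ) < k → pivot (N.col j) ≤ pivot (M.col j)
  pivot_ne : ∀ j : Fin c, (j : ℕ) < k → N.col j ≠ 0 → ∀ l < j, pivot (N.col l) ≠ pivot (N.col j)
  col_eq_of_pivot_ne : ∀ j : Fin c, (j : ℕ) < k →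
    (∀ l < j, pivot (N.col l) ≠ pivot (M.col j)) → N.col j = M.col j
  mem_span : ∀ j, M.col j ∈ Submodule.span (ZMod 2) (Set.range N.col)
  cost_le : cost ≤ k * ∑ j ∈ Finset.univ.filter (fun j : Fin c => (j : ℕ) < k), colCount (N.col j)

theorem col_updateCol_self (N : Matrix (Fin r) (Fin c) (ZMod 2)) (i : Fin c)
    (w : Fin r → ZMod 2) : (N.updateCol i w).col i = w := by
  ext k; simp [Matrix.col]

theorem col_updateCol_ne (N : Matrix (Fin r) (Fin c) (ZMod 2)) {i j : Fin c} (h : j ≠ i)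
    (w : Fin r → ZMod 2) : (N.updateCol i w).col j = N.col j := by
  ext k; simp [Matrix.col, Matrix.updateCol_ne h]

theorem IsReducedUpTo.step {M N : Matrix (Fin r) (Fin c) (ZMod 2)} {i : Fin c} {cost : ℕ}
    (h : IsReducedUpTo M i N cost) :
    IsReducedUpTo M (i + 1) (N.updateCol i (reduceColumn N i (N.col i)).1)
      (cost + (reduceColumn N i (N.col i)).2) := by
  have hi : N.col i = M.col i := h.col_eq i le_rfl
  set q := reduceColumn N i (N.col i) with hq
  have self := col_updateCol_self N i q.1
  have ne : ∀ {j : Fin c}, j ≠ i → (N.updateCol i q.1).col j = N.col j :=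
    fun hj => col_updateCol_ne N hj q.1
  have lt_or : ∀ j : Fin c, (j : ℕ) < i + 1 → j = i ∨ j < i := by
    intro j hj
    rcases Nat.lt_succ_iff_lt_or_eq.1 hj with h | h
    · exact Or.inr h
    · exact Or.inl (Fin.ext h)
  refine ⟨?_, ?_, ?_, ?_, ?_, ?_⟩
  · intro j hj
    have : j ≠ i := by rintro rfl; omega
    rw [ne this, h.col_eq j (by omega)]
  · intro j hj
    rcases lt_or j hj with rfl | hj
    · rw [self, ← hi]; exact pivot_reduceColumn_le _ _ _
    · rw [ne hj.ne]; exact h.pivot_le j hj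
  · intro j hj h0 l hl
    rcases lt_or j hj with rfl | hj
    · rw [self] at h0 ⊢
      rw [ne hl.ne]
      exact (reduceColumn_pivot_ne N j (N.col j)).resolve_left h0 l hl
    · rw [ne hj.ne] at h0 ⊢
      rw [ne (hl.trans hj).ne]
      exact h.pivot_ne j hj h0 l hl
  · intro j hj hp
    rcases lt_or j hj with rfl | hj
    · rw [self, hq, reduceColumn_of_forall_ne, hi]
      intro l hl
      rw [hi, ← ne hl.ne]
      exact hp l hl
    · rw [ne hj.ne]
      refine h.col_eq_of_pivot_ne j hj fun l hl => ?_
      rw [← ne (hl.trans hj).ne]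
      exact hp l hl
  · -- every column of `N`, including the one that is replaced, lies in the new column span
    intro j
    refine Submodule.span_le.2 ?_ (h.mem_span j)
    rintro _ ⟨l, rfl⟩
    by_cases hl : l = i
    · subst hl
      have h1 : q.1 - N.col l ∈ Submodule.span (ZMod 2)
          (Set.range (N.updateCol l q.1).col) := by
        refine Submodule.span_mono ?_ (reduceColumn_mem_span N l (N.col l))
        rintro _ ⟨k, hk, rfl⟩
        exact ⟨k, ne (ne_of_lt hk)⟩
      have h2 : q.1 ∈ Submodule.span (ZMod 2) (Set.range (N.updateCol l q.1).col) :=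
        Submodule.subset_span ⟨l, self⟩
      simpa using Submodule.sub_mem _ h2 h1
    · exact Submodule.subset_span ⟨l, ne hl⟩
  · have hsum : ∀ A : Finset (Fin c), (∀ j ∈ A, j ≠ i) →
        ∑ j ∈ A, colCount ((N.updateCol i q.1).col j) = ∑ j ∈ A, colCount (N.col j) :=
      fun A hA => Finset.sum_congr rfl fun j hj => by rw [ne (hA j hj)]
    have h1 : ∑ j ∈ Finset.univ.filter (fun j : Fin c => (j : ℕ) < i), colCount (N.col j) ≤
        ∑ j ∈ Finset.univ.filter (fun j : Fin c => (j : ℕ) < i + 1),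
          colCount ((N.updateCol i q.1).col j) := by
      rw [← hsum]
      · refine Finset.sum_le_sum_of_subset fun j hj => ?_
        simp only [Finset.mem_filter, Finset.mem_univ, true_and] at hj ⊢
        omega
      · rintro j hj rfl
        simp at hj
    have h2 : q.2 ≤
        ∑ j ∈ Finset.univ.filter (fun j : Fin c => (j : ℕ) < i), colCount (N.col j) := by
      refine (reduceColumn_cost_le N i (N.col i)).trans
        (Finset.sum_le_sum_of_subset fun j hj => ?_)
      simp only [Finset.mem_filter, Finset.mem_Iio, Finset.mem_univ, true_and] at hj ⊢
      exact hj.1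
    refine (add_le_add h.cost_le h2).trans ?_
    rw [← Nat.succ_mul]
    exact Nat.mul_le_mul_left _ h1

theorem isReducedUpTo_matrixReduction (M : Matrix (Fin r) (Fin c) (ZMod 2)) :
    IsReducedUpTo M c (matrixReduction M).1 (matrixReduction M).2 := by
  refine foldl_finRange_induction _ (M, 0)
    (P := fun k S => IsReducedUpTo M k S.1 S.2) ?_ fun i S hS => hS.step
  exact ⟨fun _ _ => rfl, fun j hj => absurd hj (by omega), fun j hj => absurd hj (by omega),
    fun j hj => absurd hj (by omega), fun j => Submodule.subset_span ⟨j, rfl⟩, Nat.zero_le _⟩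

theorem reductionCost_le (M : Matrix (Fin r) (Fin c) (ZMod 2)) :
    reductionCost M ≤ c * fillUp M := by
  have h := (isReducedUpTo_matrixReduction M).cost_le
  simpa [reductionCost, fillUp, matCount] using h

/-- Each non-zero column of the reduced matrix has an entry, and the reduced columns span the
columns of the original matrix. -/
theorem finrank_span_range_col_le_fillUp (M : Matrix (Fin r) (Fin c) (ZMod 2)) :
    Module.finrank (ZMod 2) (Submodule.span (ZMod 2) (Set.range M.col)) ≤ fillUp M := by
  classical
  set N := (matrixReduction M).1
  set A : Finset (Fin r → ZMod 2) := (Finset.univ.filter fun j => N.col j ≠ 0).image N.col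
  have hle : Submodule.span (ZMod 2) (Set.range M.col) ≤ Submodule.span (ZMod 2) (A : Set _) := by
    refine Submodule.span_le.2 ?_
    rintro _ ⟨j, rfl⟩
    refine Submodule.span_le.2 ?_ ((isReducedUpTo_matrixReduction M).mem_span j)
    rintro _ ⟨l, rfl⟩
    by_cases hl : N.col l = 0
    · change N.col l ∈ _
      rw [hl]; exact Submodule.zero_mem _
    · refine Submodule.subset_span ?_
      simp only [A, Finset.coe_image, Finset.coe_filter]
      exact ⟨l, by simpa using hl, rfl⟩
  calc _ ≤ Module.finrank (ZMod 2) (Submodule.span (ZMod 2) (A : Set (Fin r → ZMod 2))) :=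
        Submodule.finrank_mono hle
    _ ≤ A.card := finrank_span_finset_le_card A
    _ ≤ (Finset.univ.filter fun j => N.col j ≠ 0).card := Finset.card_image_le
    _ = ∑ j with N.col j ≠ 0, 1 := by simp
    _ ≤ ∑ j with N.col j ≠ 0, colCount (N.col j) :=
        Finset.sum_le_sum fun j hj => one_le_colCount (by simpa using hj)
    _ ≤ fillUp M := Finset.sum_le_sum_of_subset (Finset.filter_subset _ _)

/-- The non-zero columns of the reduced matrix have pairwise distinct pivots, so they can be
counted row by row. -/
theorem fillUp_le_sum (M : Matrix (Fin r) (Fin c) (ZMod 2)) (F : Fin r → ℕ)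
    (hF : ∀ (i : Fin r) (j : Fin c), pivot ((matrixReduction M).1.col j) = i →
      colCount ((matrixReduction M).1.col j) ≤ F i) :
    fillUp M ≤ ∑ i, F i := by
  classical
  have hred := isReducedUpTo_matrixReduction M
  unfold fillUp matCount
  generalize (matrixReduction M).1 = N at hF hred ⊢
  have hpiv : ∀ j, N.col j ≠ 0 → ∃ i : Fin r, pivot (N.col j) = i := fun j hj => by
    obtain ⟨i, hi⟩ := WithBot.ne_bot_iff_exists.1 (mt pivot_eq_bot.1 hj)
    exact ⟨i, hi.symm⟩
  have h1 : ∑ j, colCount (N.col j) = ∑ j with N.col j ≠ 0, colCount (N.col j) := by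
    symm
    refine Finset.sum_filter_of_ne fun j _ hj h0 => hj ?_
    rw [h0, colCount_zero]
  rw [h1]
  have h2 : ∀ j ∈ Finset.univ.filter fun j => N.col j ≠ 0,
      colCount (N.col j) ≤ ∑ i : Fin r, if pivot (N.col j) = i then F i else 0 := by
    intro j hj
    obtain ⟨i, hi⟩ := hpiv j (by simpa using hj)
    rw [← Finset.sum_filter]
    exact (hF i j hi).trans
      (Finset.single_le_sum (f := F) (fun _ _ => Nat.zero_le _) (by simpa using hi))
  refine (Finset.sum_le_sum h2).trans ?_
  rw [Finset.sum_comm]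
  refine Finset.sum_le_sum fun i _ => ?_
  rw [← Finset.sum_filter, Finset.sum_const, smul_eq_mul]
  refine (Nat.mul_le_mul_right _ (Finset.card_le_one.2 ?_)).trans (one_mul _).le
  intro j hj l hl
  simp only [Finset.mem_filter, Finset.mem_univ, true_and] at hj hl
  rcases lt_trichotomy j l with h | h | h
  · exact absurd (hj.2.trans hl.2.symm) (hred.pivot_ne l l.2 hl.1 j h)
  · exact h
  · exact absurd (hl.2.trans hj.2.symm) (hred.pivot_ne j j.2 hj.1 l h)

/-- A column whose pivot lies below all entries of the preceding columns is not changed by the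
reduction, and it is the only reduced column with this pivot. -/
theorem col_matrixReduction_eq {M : Matrix (Fin r) (Fin c) (ZMod 2)} {i : Fin r} {j₀ j : Fin c}
    (hj₀ : pivot (M.col j₀) = i) (hlt : ∀ l < j₀, pivot (M.col l) < i)
    (hj : pivot ((matrixReduction M).1.col j) = i) :
    (matrixReduction M).1.col j = M.col j₀ := by
  have hred := isReducedUpTo_matrixReduction M
  generalize (matrixReduction M).1 = N at hred hj ⊢
  have h0 : N.col j₀ = M.col j₀ := hred.col_eq_of_pivot_ne j₀ j₀.2 fun l hl => by
    rw [hj₀]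
    exact ((hred.pivot_le l l.2).trans_lt (hlt l hl)).ne
  have hne : ∀ k, pivot (N.col k) = i → N.col k ≠ 0 := fun k hk h => by
    rw [h, pivot_zero] at hk
    exact WithBot.bot_ne_coe hk
  have hp0 : pivot (N.col j₀) = i := by rw [h0, hj₀]
  rcases lt_trichotomy j j₀ with h | h | h
  · exact absurd (hj.trans hp0.symm) (hred.pivot_ne j₀ j₀.2 (hne _ hp0) j h)
  · rw [h, h0]
  · exact absurd (hp0.trans hj.symm) (hred.pivot_ne j j.2 (hne _ hj) j₀ h)

end ReductionLemmas

/-! ### Apparent pairs and the rank of the boundary matrix -/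

section CliqueFiltration

variable {n k : ℕ}

theorem boundaryMatrix_ne_zero {σ : SimplexOrder n k} {τ : SimplexOrder n (k + 1)}
    {i : Fin (n.choose (k + 1))} {j : Fin (n.choose (k + 1 + 1))} :
    (boundaryMatrix σ τ).col j i ≠ 0 ↔ (σ i).1 ⊆ (τ j).1 := by
  simp [boundaryMatrix, Matrix.col]

theorem colCount_boundaryMatrix_le (σ : SimplexOrder n k) (τ : SimplexOrder n (k + 1))
    (j : Fin (n.choose (k + 1 + 1))) : colCount ((boundaryMatrix σ τ).col j) ≤ k + 2 := by
  have h : colCount ((boundaryMatrix σ τ).col j) ≤ ((τ j).1.powersetCard (k + 1)).card := by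
    refine Finset.card_le_card_of_injOn (fun i => (σ i).1) (fun i hi => ?_)
      (fun a _ b _ hab => σ.injective (Subtype.ext hab))
    exact Finset.mem_powersetCard.2
      ⟨boundaryMatrix_ne_zero.1 (Finset.mem_filter.1 (Finset.mem_coe.1 hi)).2, (σ i).2⟩
  rwa [Finset.card_powersetCard, (τ j).2, Nat.choose_succ_self_right] at h

theorem entryTime_le_iff (σ : SimplexOrder n k) {s : Finset (Fin n)} (hs : s.Nonempty) {i : ℕ} :
    entryTime σ s ≤ i ↔ ∀ e : Simplex n k, e.1 ⊆ s → (σ.symm e : ℕ) < i := by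
  constructor
  · intro h e he
    have hmem : s ∈ cliqueComplex σ (entryTime σ s) :=
      Nat.sInf_mem (s := {i | s ∈ cliqueComplex σ i}) ⟨_, hs, fun e _ => (σ.symm e).2⟩
    exact (hmem.2 e he).trans_le h
  · exact fun h => Nat.sInf_le ⟨hs, h⟩

theorem Simplex.nonempty (s : Simplex n k) : s.1.Nonempty :=
  Finset.card_pos.1 (by rw [s.2]; omega)

/-- If some simplex has the `i`-th facet as its last one, then the first such simplex in the
order `τ` has an unreduced column with pivot `i`; hence any reduced column with pivot `i` is a
column of the boundary matrix. -/
theorem colCount_le_of_apparent {σ : SimplexOrder n k} {τ : SimplexOrder n (k + 1)}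
    (hτ : RespectsCliqueFiltration σ τ) {i : Fin (n.choose (k + 1))} {T : Simplex n (k + 1)}
    (hiT : (σ i).1 ⊆ T.1) (hT : ∀ e : Simplex n k, e.1 ⊆ T.1 → σ.symm e ≤ i)
    {j : Fin (n.choose (k + 1 + 1))}
    (hj : pivot ((matrixReduction (boundaryMatrix σ τ)).1.col j) = i) :
    colCount ((matrixReduction (boundaryMatrix σ τ)).1.col j) ≤ k + 2 := by
  classical
  have hentry : ∀ S : Simplex n (k + 1), entryTime σ S.1 = i + 1 ↔
      (σ i).1 ⊆ S.1 ∧ ∀ e : Simplex n k, e.1 ⊆ S.1 → σ.symm e ≤ i := by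
    intro S
    have h1 := entryTime_le_iff σ S.nonempty (i := i + 1)
    have h2 := entryTime_le_iff σ S.nonempty (i := i)
    simp only [Nat.lt_succ_iff, Fin.val_fin_le] at h1
    constructor
    · intro h
      have h3 := h1.1 h.le
      refine ⟨?_, h3⟩
      by_contra hi
      have h4 : entryTime σ S.1 ≤ i := h2.2 fun e he => by
        refine lt_of_le_of_ne (h3 e he) fun hei => hi ?_
        rw [← Fin.ext hei, Equiv.apply_symm_apply]
        exact he
      omega
    · rintro ⟨hi, h3⟩
      have h4 := h1.2 h3
      have h5 : ¬ entryTime σ S.1 ≤ i := fun h => by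
        have := h2.1 h (σ i) hi
        simp at this
      omega
  set B : Finset (Fin (n.choose (k + 1 + 1))) :=
    Finset.univ.filter fun j => entryTime σ (τ j).1 = i + 1
  have hB : B.Nonempty := ⟨τ.symm T, by simpa [B] using (hentry T).2 ⟨hiT, hT⟩⟩
  have hmem : entryTime σ (τ (B.min' hB)).1 = i + 1 := by simpa [B] using B.min'_mem hB
  obtain ⟨hi0, hle0⟩ := (hentry _).1 hmem
  have hcol := col_matrixReduction_eq (M := boundaryMatrix σ τ) (i := i) (j₀ := B.min' hB) (j := j)
    (pivot_eq_coe (boundaryMatrix_ne_zero.2 hi0) fun l hl => by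
      simpa using hle0 (σ l) (boundaryMatrix_ne_zero.1 hl))
    (fun l hl => by
      have hlB : entryTime σ (τ l).1 ≠ i + 1 := fun h =>
        absurd (B.min'_le l (by simpa [B] using h)) (not_le.2 hl)
      have hle : entryTime σ (τ l).1 ≤ entryTime σ (τ (B.min' hB)).1 := hτ hl.le
      have hle' : entryTime σ (τ l).1 ≤ i := by omega
      refine pivot_lt_coe fun m hm => ?_
      simpa using (entryTime_le_iff σ (τ l).nonempty).1 hle' (σ m) (boundaryMatrix_ne_zero.1 hm))
    hj
  rw [hcol]
  exact colCount_boundaryMatrix_le σ τ _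

theorem fillUp_le_sum_of_apparent {σ : SimplexOrder n k} {τ : SimplexOrder n (k + 1)}
    (hτ : RespectsCliqueFiltration σ τ) (A : Finset (Fin (n.choose (k + 1))))
    (hA : ∀ i ∉ A, ∃ T : Simplex n (k + 1), (σ i).1 ⊆ T.1 ∧
      ∀ e : Simplex n k, e.1 ⊆ T.1 → σ.symm e ≤ i) :
    fillUp (boundaryMatrix σ τ) ≤ (k + 2) * n.choose (k + 1) + ∑ i ∈ A, ((i : ℕ) + 1) := by
  classical
  refine (fillUp_le_sum _ (fun i => (k + 2) + if i ∈ A then (i : ℕ) + 1 else 0)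
    fun i j hij => ?_).trans_eq ?_
  · by_cases hi : i ∈ A
    · have := colCount_le_of_pivot hij
      simp only [hi, if_true]
      omega
    · obtain ⟨T, hiT, hT⟩ := hA i hi
      exact (colCount_le_of_apparent hτ hiT hT hij).trans (Nat.le_add_right _ _)
  · simp [Finset.sum_add_distrib, mul_comm]

theorem fillUp_le_sq {r c : ℕ} (M : Matrix (Fin r) (Fin c) (ZMod 2)) : fillUp M ≤ r ^ 2 := by
  refine (fillUp_le_sum M (fun _ => r) fun i j hij => ?_).trans_eq (by simp [sq])
  exact (colCount_le_of_pivot hij).trans i.2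

/-- The simplices that contain a fixed vertex `v` give linearly independent columns, since the
facet opposite to `v` lies in no other of them. -/
theorem choose_le_fillUp (σ : SimplexOrder (n + 1) k) (τ : SimplexOrder (n + 1) (k + 1)) :
    n.choose (k + 1) ≤ fillUp (boundaryMatrix σ τ) := by
  classical
  set v : Fin (n + 1) := 0
  set A := {i // v ∉ (σ i).1}
  have hins : ∀ i : A, (insert v (σ i.1).1).card = k + 1 + 1 := fun i => by
    rw [Finset.card_insert_of_notMem i.2, (σ i.1).2]
  set f : A → Fin ((n + 1).choose (k + 1 + 1)) := fun i => τ.symm ⟨insert v (σ i.1).1, hins i⟩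
  have hli : LinearIndependent (ZMod 2) fun i : A => (boundaryMatrix σ τ).col (f i) := by
    refine LinearIndependent.of_comp
      (LinearMap.funLeft (ZMod 2) (ZMod 2) (Subtype.val : A → _)) ?_
    have hcomp : (LinearMap.funLeft (ZMod 2) (ZMod 2) (Subtype.val : A → _)) ∘
        (fun i : A => (boundaryMatrix σ τ).col (f i)) = fun i => Pi.single i 1 := by
      funext i l
      have hsub : (σ l.1).1 ⊆ (τ (f i)).1 ↔ l = i := by
        simp only [f, Equiv.apply_symm_apply]
        rw [Finset.subset_insert_iff_of_notMem l.2]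
        constructor
        · intro h
          have h1 := Finset.eq_of_subset_of_card_le h (by rw [(σ l.1).2, (σ i.1).2])
          exact Subtype.ext (σ.injective (Subtype.ext h1))
        · rintro rfl
          exact subset_rfl
      simp [LinearMap.funLeft_apply, boundaryMatrix, Matrix.col, hsub, Pi.single_apply]
    rw [hcomp]
    exact Pi.linearIndependent_single_one A (ZMod 2)
  have hcard : n.choose (k + 1) ≤ Fintype.card A := by
    have h1 : n.choose (k + 1) = ((Finset.univ.erase v).powersetCard (k + 1)).card := by
      simp
    rw [h1, ← Fintype.card_coe]
    refine Fintype.card_le_of_injective (fun s : (Finset.univ.erase v).powersetCard (k + 1) =>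
      (⟨σ.symm ⟨s.1, (Finset.mem_powersetCard.1 s.2).2⟩, by
        simp only [Equiv.apply_symm_apply]
        exact fun h => by simpa using (Finset.mem_powersetCard.1 s.2).1 h⟩ : A)) ?_
    intro s t hst
    have h2 := σ.symm.injective (congrArg Subtype.val hst)
    exact Subtype.ext (Subtype.mk.inj h2)
  calc n.choose (k + 1) ≤ Fintype.card A := hcard
    _ = Module.finrank (ZMod 2)
        (Submodule.span (ZMod 2) (Set.range fun i : A => (boundaryMatrix σ τ).col (f i))) :=
      (finrank_span_eq_card hli).symm
    _ ≤ Module.finrank (ZMod 2)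
        (Submodule.span (ZMod 2) (Set.range (boundaryMatrix σ τ).col)) := by
      refine Submodule.finrank_mono (Submodule.span_mono ?_)
      rintro _ ⟨i, rfl⟩
      exact ⟨f i, rfl⟩
    _ ≤ _ := finrank_span_range_col_le_fillUp _

theorem choose_two_sub_le_fillUp (σ : SimplexOrder n 1) (τ : SimplexOrder n 2) :
    (n.choose 2 : ℝ) - n ≤ fillUp (boundaryMatrix σ τ) := by
  rcases n with _ | n
  · simp
  · have h : (n.choose 2 : ℝ) ≤ fillUp (boundaryMatrix σ τ) :=
      Nat.cast_le.2 (choose_le_fillUp (k := 1) σ τ)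
    have h2 : ((n + 1).choose 2 : ℝ) = n + n.choose 2 := by
      rw [Nat.choose_succ_succ' n 1, Nat.choose_one_right, Nat.cast_add]
    refine le_trans ?_ h
    rw [h2, Nat.cast_succ]
    linarith

theorem sq_le_fillUp (hn : 3 ≤ n) (σ : SimplexOrder n 1) (τ : SimplexOrder n 2) :
    (1 / 9 : ℝ) * (n : ℝ) ^ 2 ≤ fillUp (boundaryMatrix σ τ) := by
  obtain ⟨m, rfl⟩ := Nat.exists_eq_add_of_le' hn
  have h : ((m + 2).choose 2 : ℝ) ≤ fillUp (boundaryMatrix σ τ) :=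
    Nat.cast_le.2 (choose_le_fillUp (k := 1) σ τ)
  refine le_trans ?_ h
  rw [Nat.cast_choose_two]
  push_cast
  have : (0 : ℝ) ≤ m := m.cast_nonneg
  nlinarith

end CliqueFiltration

/-! ### Edge lengths and the Vietoris–Rips order -/

section VietorisRips

variable {n d : ℕ}

theorem edgeLength_eq_dist (x : Fin n → EuclideanSpace ℝ (Fin d)) {e : Simplex n 1} {a b : Fin n}
    (h : e.1 = {a, b}) : edgeLength x e = dist (x a) (x b) := by
  rw [edgeLength, h, Finset.coe_pair, Set.image_pair, Metric.diam_pair]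

theorem Simplex.exists_eq_pair (e : Simplex n 1) : ∃ a b, a ≠ b ∧ e.1 = {a, b} :=
  Finset.card_eq_two.1 e.2

/-- The edges of length at most `R`. -/
noncomputable def shortEdges (x : Fin n → EuclideanSpace ℝ (Fin d)) (R : ℝ) :
    Finset (Simplex n 1) :=
  Finset.univ.filter fun e => edgeLength x e ≤ R

/-- A longest edge of a triangle is the pivot of an unreduced column, so only short edges
contribute long columns, and the column of a short edge has entries in rows of short edges. -/
theorem IsVietorisRipsOrder.fillUp_le {x : Fin n → EuclideanSpace ℝ (Fin d)}
    {σ : SimplexOrder n 1} {τ : SimplexOrder n 2} (h : IsVietorisRipsOrder x σ τ) {R : ℝ}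
    (hR : ∀ a b, a ≠ b → R < dist (x a) (x b) → ∃ c, c ≠ a ∧ c ≠ b ∧
      dist (x a) (x c) < dist (x a) (x b) ∧ dist (x b) (x c) < dist (x a) (x b)) :
    fillUp (boundaryMatrix σ τ) ≤ 3 * n.choose 2 + (shortEdges x R).card ^ 2 := by
  classical
  set A : Finset (Fin (n.choose (1 + 1))) :=
    Finset.univ.filter fun i => edgeLength x (σ i) ≤ R
  have hcardA : A.card ≤ (shortEdges x R).card :=
    Finset.card_le_card_of_injOn σ (fun i hi => by simpa [A, shortEdges] using hi)
      σ.injective.injOn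
  refine (fillUp_le_sum_of_apparent h.respects A fun i hi => ?_).trans
    (Nat.add_le_add_left ?_ _)
  · have hiR : R < edgeLength x (σ i) := by simpa [A] using hi
    obtain ⟨a, b, hab, hσ⟩ := (σ i).exists_eq_pair
    have hlen := edgeLength_eq_dist x hσ
    obtain ⟨c, hca, hcb, hac, hbc⟩ := hR a b hab (hlen ▸ hiR)
    refine ⟨⟨{a, b, c}, Finset.card_eq_three.2 ⟨a, b, c, hab, hca.symm, hcb.symm, rfl⟩⟩,
      ?_, fun e he => ?_⟩
    · rw [hσ]
      intro y hy
      simp only [Finset.mem_insert, Finset.mem_singleton] at hy ⊢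
      tauto
    · have hlt : edgeLength x e < edgeLength x (σ i) → σ.symm e ≤ i := by
        intro hl
        by_contra hle
        have := h.sorted (not_le.1 hle).le
        simp only [Equiv.apply_symm_apply] at this
        exact absurd this (not_le.2 hl)
      obtain ⟨p, q, hpq, hepq⟩ := e.exists_eq_pair
      have heq : e.1 = {a, b} → σ.symm e ≤ i := fun h1 => by
        rw [Subtype.ext (h1.trans hσ.symm), Equiv.symm_apply_apply]
      have hp : p ∈ ({a, b, c} : Finset (Fin n)) := he (by simp [hepq])
      have hq : q ∈ ({a, b, c} : Finset (Fin n)) := he (by simp [hepq])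
      simp only [Finset.mem_insert, Finset.mem_singleton] at hp hq
      have hd := edgeLength_eq_dist x hepq
      rw [hd, hlen] at hlt
      rcases hp with rfl | rfl | rfl <;> rcases hq with rfl | rfl | rfl
      · exact absurd rfl hpq
      · exact heq hepq
      · exact hlt hac
      · exact heq (hepq.trans (Finset.pair_comm _ _))
      · exact absurd rfl hpq
      · exact hlt hbc
      · exact hlt (by rwa [dist_comm])
      · exact hlt (by rwa [dist_comm])
      · exact absurd rfl hpq
  · -- rows up to a short edge belong to short edges
    have hi : ∀ i ∈ A, (i : ℕ) + 1 ≤ A.card := by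
      intro i hi
      have hsub : Finset.Iic i ⊆ A := fun l hl => by
        have hli := h.sorted (Finset.mem_Iic.1 hl)
        have : edgeLength x (σ i) ≤ R := by simpa [A] using hi
        simpa [A] using hli.trans this
      simpa using Finset.card_le_card hsub
    calc ∑ i ∈ A, ((i : ℕ) + 1) ≤ ∑ _i ∈ A, A.card := Finset.sum_le_sum hi
      _ = A.card ^ 2 := by simp [sq]
      _ ≤ _ := Nat.pow_le_pow_left hcardA 2

theorem fillUp_eq_zero_of_le_two (hn : n ≤ 2) (σ : SimplexOrder n 1) (τ : SimplexOrder n 2) :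
    fillUp (boundaryMatrix σ τ) = 0 := by
  have h : n.choose (1 + 1 + 1) = 0 := Nat.choose_eq_zero_of_lt (by omega)
  have : IsEmpty (Fin (n.choose (1 + 1 + 1))) := by rw [h]; infer_instance
  simp [fillUp, matCount]

end VietorisRips

/-! ### Uniform points in the cube -/

section UniformCube

open scoped ENNReal

variable {d : ℕ}

theorem volume_box (l u : Fin d → ℝ) :
    volume {x : EuclideanSpace ℝ (Fin d) | ∀ i, x i ∈ Set.Icc (l i) (u i)} =
      ∏ i, ENNReal.ofReal (u i - l i) := by
  have h : {x : EuclideanSpace ℝ (Fin d) | ∀ i, x i ∈ Set.Icc (l i) (u i)} =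
      (WithLp.ofLp : EuclideanSpace ℝ (Fin d) → (Fin d → ℝ)) ⁻¹' Set.Icc l u := by
    ext x
    simp [Set.mem_Icc, Pi.le_def, forall_and]
  rw [h, (PiLp.volume_preserving_ofLp (Fin d)).measure_preimage
    measurableSet_Icc.nullMeasurableSet, Real.volume_Icc_pi]

theorem volume_unitCube : volume (unitCube d) = 1 := by
  have h := volume_box (d := d) (fun _ => 0) (fun _ => 1)
  simpa [unitCube] using h

theorem measurableSet_unitCube : MeasurableSet (unitCube d) := by
  have h : IsClosed (unitCube d) := by
    simp only [unitCube, Set.ofPred_forall]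
    refine isClosed_iInter fun i => ?_
    exact isClosed_Icc.preimage (by fun_prop : Continuous fun x : EuclideanSpace ℝ (Fin d) => x i)
  exact h.measurableSet

/-- The uniform distribution on the unit cube. -/
noncomputable def uniformCube (d : ℕ) : Measure (EuclideanSpace ℝ (Fin d)) :=
  ProbabilityTheory.cond volume (unitCube d)

theorem uniformCube_apply (s : Set (EuclideanSpace ℝ (Fin d))) :
    uniformCube d s = volume (unitCube d ∩ s) := by
  rw [uniformCube, cond_apply measurableSet_unitCube, volume_unitCube, inv_one, one_mul]

instance : IsProbabilityMeasure (uniformCube d) :=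
  ⟨by rw [uniformCube_apply, Set.inter_univ, volume_unitCube]⟩

theorem uniformCube_closedBall_le (x : EuclideanSpace ℝ (Fin d)) (R : ℝ) :
    uniformCube d (Metric.closedBall x R) ≤ ENNReal.ofReal (2 * R) ^ d := by
  have hsub : Metric.closedBall x R ⊆
      {y : EuclideanSpace ℝ (Fin d) | ∀ i, y i ∈ Set.Icc (x i - R) (x i + R)} := by
    intro y hy i
    have h1 : ‖(y - x) i‖ ≤ ‖y - x‖ := PiLp.norm_apply_le (y - x) i
    rw [← dist_eq_norm] at h1
    have h2 := abs_le.1 ((Real.norm_eq_abs _).symm.le.trans (h1.trans (Metric.mem_closedBall.1 hy)))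
    simp only [PiLp.sub_apply] at h2
    exact ⟨by linarith [h2.1], by linarith [h2.2]⟩
  rw [uniformCube_apply]
  refine (measure_mono (Set.inter_subset_right.trans hsub)).trans_eq ?_
  rw [volume_box]
  simp [show ∀ z : ℝ, z + R - (z - R) = 2 * R from fun z => by ring]

theorem dist_le_of_mem_unitCube {a b : EuclideanSpace ℝ (Fin d)} (ha : a ∈ unitCube d)
    (hb : b ∈ unitCube d) : dist a b ≤ d := by
  rw [EuclideanSpace.dist_eq]
  refine Real.sqrt_le_iff.2 ⟨d.cast_nonneg, ?_⟩
  have h : ∀ i ∈ (Finset.univ : Finset (Fin d)), dist (a i) (b i) ^ 2 ≤ 1 := by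
    intro i _
    rw [Real.dist_eq, sq_abs, sq_le_one_iff_abs_le_one, abs_le]
    obtain ⟨h1, h2⟩ := ha i
    obtain ⟨h3, h4⟩ := hb i
    constructor <;> linarith
  refine (Finset.sum_le_sum h).trans ?_
  rw [Finset.sum_const, Finset.card_univ, Fintype.card_fin, nsmul_eq_mul, mul_one]
  exact_mod_cast Nat.le_self_pow two_ne_zero d

/-- Any two points of the cube at distance `r` leave, in the ball that has them as antipodal
points, a share of the cube of measure at least a constant times `r ^ d`: a box of side `r / (4 d)`
with a corner at the centre of the ball, pointing inwards in every coordinate. -/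
theorem le_uniformCube_ball (hd : 1 ≤ d) {a b : EuclideanSpace ℝ (Fin d)} (ha : a ∈ unitCube d)
    (hb : b ∈ unitCube d) (hab : a ≠ b) :
    ENNReal.ofReal (dist a b / (4 * d)) ^ d ≤
      uniformCube d (Metric.ball ((2⁻¹ : ℝ) • (a + b)) (dist a b / 2)) := by
  have hd0 : (1 : ℝ) ≤ d := by exact_mod_cast hd
  have hr : 0 < dist a b := dist_pos.2 hab
  set m := (2⁻¹ : ℝ) • (a + b) with hm
  set s := dist a b / (4 * d) with hs
  have hs0 : 0 < s := by positivity
  have hs1 : s ≤ 1 / 4 := by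
    rw [hs, div_le_iff₀ (by positivity)]
    linarith [dist_le_of_mem_unitCube ha hb]
  have hmQ : ∀ i, 0 ≤ m i ∧ m i ≤ 1 := fun i => by
    obtain ⟨h1, h2⟩ := ha i
    obtain ⟨h3, h4⟩ := hb i
    simp only [hm, PiLp.smul_apply, PiLp.add_apply, smul_eq_mul]
    constructor <;> linarith
  set l : Fin d → ℝ := fun i => if m i ≤ 1 / 2 then m i else m i - s with hl
  have hl' : ∀ i, 0 ≤ l i ∧ l i + s ≤ 1 ∧ l i ≤ m i ∧ m i ≤ l i + s := fun i => by
    obtain ⟨h1, h2⟩ := hmQ i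
    simp only [hl]
    split_ifs <;> refine ⟨?_, ?_, ?_, ?_⟩ <;> linarith
  have hsub : {x : EuclideanSpace ℝ (Fin d) | ∀ i, x i ∈ Set.Icc (l i) (l i + s)} ⊆
      unitCube d ∩ Metric.ball m (dist a b / 2) := by
    intro x hx
    refine ⟨fun i => ⟨(hl' i).1.trans (hx i).1, (hx i).2.trans (hl' i).2.1⟩, ?_⟩
    rw [Metric.mem_ball, EuclideanSpace.dist_eq]
    refine (Real.sqrt_lt' (by positivity)).2 ?_
    have h : ∀ i ∈ (Finset.univ : Finset (Fin d)), dist (x i) (m i) ^ 2 ≤ s ^ 2 := by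
      intro i _
      rw [Real.dist_eq, sq_abs]
      refine sq_le_sq' ?_ ?_
      · linarith [(hx i).1, (hl' i).2.2.2]
      · linarith [(hx i).2, (hl' i).2.2.1]
    refine (Finset.sum_le_sum h).trans_lt ?_
    rw [Finset.sum_const, Finset.card_univ, Fintype.card_fin, nsmul_eq_mul]
    have hds : (d : ℝ) * s = dist a b / 4 := by rw [hs]; field_simp
    have h1 : (d : ℝ) * s ^ 2 ≤ (d * s) ^ 2 := by
      rw [mul_pow]
      exact mul_le_mul_of_nonneg_right (le_self_pow₀ hd0 two_ne_zero) (sq_nonneg s)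
    rw [hds] at h1
    nlinarith
  rw [uniformCube_apply]
  refine le_trans (le_of_eq ?_) (measure_mono hsub)
  rw [volume_box]
  simp

/-- Integrating out one coordinate: if `A` does not depend on the coordinate `c` and, given any
point of `A`, resampling that coordinate leads into `G` with probability at most `q`, then
`P (A ∩ G) ≤ q * P A`. -/
theorem measure_pi_inter_le {ι E : Type*} [Fintype ι] [DecidableEq ι] [MeasurableSpace E]
    (ν : Measure E) [IsProbabilityMeasure ν] (c : ι) {A G : Set (ι → E)} (hA : MeasurableSet A)
    (hG : MeasurableSet G) (hAc : ∀ x y, Function.update x c y ∈ A ↔ x ∈ A) {q : ℝ≥0∞}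
    (hq : ∀ x ∈ A, ν {y | Function.update x c y ∈ G} ≤ q) :
    Measure.pi (fun _ => ν) (A ∩ G) ≤ q * Measure.pi (fun _ => ν) A := by
  rw [← lintegral_indicator_one (hA.inter hG), ← lintegral_indicator_one hA,
    ← lintegral_const_mul q (measurable_one.indicator hA)]
  refine lintegral_le_of_lmarginal_le {c} (measurable_one.indicator (hA.inter hG))
    ((measurable_one.indicator hA).const_mul q) ?_
  rw [lmarginal_singleton, lmarginal_singleton]
  intro x
  by_cases hx : x ∈ A
  · have h1 : ∀ y, (A ∩ G).indicator (1 : (ι → E) → ℝ≥0∞) (Function.update x c y) =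
        (Function.update x c ⁻¹' G).indicator 1 y := fun y => by
      by_cases hy : Function.update x c y ∈ G <;> simp [hAc, hx, hy]
    have h2 : ∀ y, A.indicator (1 : (ι → E) → ℝ≥0∞) (Function.update x c y) = 1 := fun y => by
      simp [hAc, hx]
    simp only [h1, h2]
    rw [lintegral_indicator_one (hG.preimage (measurable_update x))]
    rw [lintegral_const, measure_univ, mul_one, mul_one]
    exact hq x hx
  · have h1 : ∀ y, (A ∩ G).indicator (1 : (ι → E) → ℝ≥0∞) (Function.update x c y) = 0 :=
      fun y => by simp [hAc, hx]
    simp [h1]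

end UniformCube

/-! ### Short edges and empty balls for independent points -/

section RandomPoints

open scoped ENNReal

variable {n d : ℕ}

/-- The configurations for which the edge `e` has length at most `R`. -/
def shortEvent (d : ℕ) (R : ℝ) (e : Simplex n 1) : Set (Fin n → EuclideanSpace ℝ (Fin d)) :=
  {x | edgeLength x e ≤ R}

theorem measurableSet_shortEvent (R : ℝ) (e : Simplex n 1) :
    MeasurableSet (shortEvent d R e) := by
  obtain ⟨a, b, -, h⟩ := e.exists_eq_pair
  simp only [shortEvent, edgeLength_eq_dist _ h]
  exact measurableSet_le (by fun_prop) measurable_const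

/-- The uniform distribution of `n` independent points in the cube. -/
noncomputable def pointMeasure (n d : ℕ) : Measure (Fin n → EuclideanSpace ℝ (Fin d)) :=
  Measure.pi fun _ => uniformCube d

instance : IsProbabilityMeasure (pointMeasure n d) := by
  unfold pointMeasure; infer_instance

theorem measure_inter_shortEvent_le (R : ℝ) {e : Simplex n 1} {c : Fin n} (hc : c ∈ e.1)
    {A : Set (Fin n → EuclideanSpace ℝ (Fin d))} (hA : MeasurableSet A)
    (hAc : ∀ x y, Function.update x c y ∈ A ↔ x ∈ A) :
    pointMeasure n d (A ∩ shortEvent d R e) ≤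
      ENNReal.ofReal (2 * R) ^ d * pointMeasure n d A := by
  refine measure_pi_inter_le (uniformCube d) c hA (measurableSet_shortEvent R e) hAc fun x _ => ?_
  obtain ⟨a, hac, hea⟩ : ∃ a, a ≠ c ∧ e.1 = {c, a} := by
    obtain ⟨p, q, hpq, h⟩ := e.exists_eq_pair
    rw [h, Finset.mem_insert, Finset.mem_singleton] at hc
    rcases hc with rfl | rfl
    · exact ⟨q, hpq.symm, h⟩
    · exact ⟨p, hpq, h.trans (Finset.pair_comm _ _)⟩
  refine (measure_mono fun y hy => ?_).trans (uniformCube_closedBall_le (x a) R)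
  simpa [shortEvent, edgeLength_eq_dist _ hea, hac] using hy

theorem measure_shortEvent_le (R : ℝ) (e : Simplex n 1) :
    pointMeasure n d (shortEvent d R e) ≤ ENNReal.ofReal (2 * R) ^ d := by
  obtain ⟨c, hc⟩ := e.nonempty
  simpa using measure_inter_shortEvent_le (d := d) R hc MeasurableSet.univ (by simp)

/-- The edge `f` has an endpoint `c` that is not on `e`. Whatever the other points are, `f` is
short only if `c` falls into a fixed ball; so the product bound holds even if the two edges share
a vertex. -/
theorem measure_shortEvent_inter_le (R : ℝ) {e f : Simplex n 1} (hef : e ≠ f) :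
    pointMeasure n d (shortEvent d R e ∩ shortEvent d R f) ≤
      (ENNReal.ofReal (2 * R) ^ d) ^ 2 := by
  obtain ⟨c, hcf, hce⟩ : ∃ c ∈ f.1, c ∉ e.1 := by
    by_contra! h
    exact hef (Subtype.ext (Finset.eq_of_subset_of_card_le h (by rw [e.2, f.2])).symm)
  obtain ⟨a, b, -, he⟩ := e.exists_eq_pair
  have hca : a ≠ c := by rintro rfl; exact hce (by simp [he])
  have hcb : b ≠ c := by rintro rfl; exact hce (by simp [he])
  refine (measure_inter_shortEvent_le R hcf (measurableSet_shortEvent R e) fun x y => ?_).trans ?_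
  · simp [shortEvent, edgeLength_eq_dist _ he, hca, hcb]
  · rw [sq]
    exact mul_le_mul_right (measure_shortEvent_le R e) _

/-- The configurations in which `a` and `b` lie in the cube at distance more than `R`, and none of
the points of `s` lies in the open ball with `a` and `b` as antipodal points. -/
def emptyBallEvent (d : ℕ) (R : ℝ) (a b : Fin n) (s : Finset (Fin n)) :
    Set (Fin n → EuclideanSpace ℝ (Fin d)) :=
  {x | (x a ∈ unitCube d ∧ x b ∈ unitCube d ∧ R < dist (x a) (x b)) ∧
    ∀ c ∈ s, dist (x a) (x b) / 2 ≤ dist (x c) ((2⁻¹ : ℝ) • (x a + x b))}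

theorem measurableSet_emptyBallEvent (R : ℝ) (a b : Fin n) (s : Finset (Fin n)) :
    MeasurableSet (emptyBallEvent d R a b s) := by
  have h : emptyBallEvent d R a b s = ((fun x => x a) ⁻¹' unitCube d ∩
      ((fun x => x b) ⁻¹' unitCube d ∩ {x | R < dist (x a) (x b)})) ∩
      ⋂ c ∈ s, {x | dist (x a) (x b) / 2 ≤ dist (x c) ((2⁻¹ : ℝ) • (x a + x b))} := by
    ext x
    simp [emptyBallEvent]
  rw [h]
  refine ((measurableSet_unitCube.preimage (measurable_pi_apply a)).inter
    ((measurableSet_unitCube.preimage (measurable_pi_apply b)).inter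
      (measurableSet_lt measurable_const (by fun_prop)))).inter ?_
  exact Finset.measurableSet_biInter s fun c _ => measurableSet_le (by fun_prop) (by fun_prop)

theorem measure_emptyBallEvent_le (hd : 1 ≤ d) {R : ℝ} (hR : 0 ≤ R) {a b : Fin n}
    (s : Finset (Fin n)) (ha : a ∉ s) (hb : b ∉ s) :
    pointMeasure n d (emptyBallEvent d R a b s) ≤
      ENNReal.ofReal (Real.exp (-(R / (4 * d)) ^ d)) ^ s.card := by
  classical
  -- the points of `s` are integrated out one by one
  induction s using Finset.induction_on with
  | empty => simpa using prob_le_one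
  | insert c s hcs ih =>
    simp only [Finset.mem_insert, not_or] at ha hb
    have hset : emptyBallEvent d R a b (insert c s) = emptyBallEvent d R a b s ∩
        {x | dist (x a) (x b) / 2 ≤ dist (x c) ((2⁻¹ : ℝ) • (x a + x b))} := by
      ext x
      simp only [emptyBallEvent, Set.mem_ofPred_eq, Finset.forall_mem_insert, Set.mem_inter_iff]
      tauto
    rw [hset, Finset.card_insert_of_notMem hcs, pow_succ']
    refine (measure_pi_inter_le (uniformCube d) c (measurableSet_emptyBallEvent R a b s)
      (measurableSet_le (by fun_prop) (by fun_prop)) (fun x y => ?_) fun x hx => ?_).trans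
      (mul_le_mul_right (ih ha.2 hb.2) _)
    · have h : ∀ k ∈ s, Function.update x c y k = x k := fun k hk =>
        Function.update_of_ne (by rintro rfl; exact hcs hk) _ _
      simp only [emptyBallEvent, Set.mem_ofPred_eq, Function.update_of_ne ha.1,
        Function.update_of_ne hb.1]
      refine and_congr_right fun _ => forall₂_congr fun k hk => ?_
      rw [h k hk]
    · obtain ⟨⟨hxa, hxb, hxR⟩, -⟩ := hx
      have hne : x a ≠ x b := dist_pos.1 (hR.trans_lt hxR)
      have hball := le_uniformCube_ball hd hxa hxb hne
      have hcompl : {y | Function.update x c y ∈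
          {x | dist (x a) (x b) / 2 ≤ dist (x c) ((2⁻¹ : ℝ) • (x a + x b))}} =
          (Metric.ball ((2⁻¹ : ℝ) • (x a + x b)) (dist (x a) (x b) / 2))ᶜ := by
        ext y
        simp [Function.update_of_ne ha.1, Function.update_of_ne hb.1]
      rw [hcompl, prob_compl_eq_one_sub measurableSet_ball, tsub_le_iff_right]
      refine le_trans ?_ (add_le_add_right hball _)
      rw [← ENNReal.ofReal_pow (by positivity), ← ENNReal.ofReal_add (by positivity)
        (by positivity), ← ENNReal.ofReal_one]
      refine ENNReal.ofReal_le_ofReal ?_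
      have h1 := Real.add_one_le_exp (-(R / (4 * d)) ^ d)
      have h2 : (R / (4 * d)) ^ d ≤ (dist (x a) (x b) / (4 * d)) ^ d := by gcongr
      linarith

end RandomPoints

/-! ### The expected fill-up -/

section Expectation

open scoped ENNReal

variable {n d : ℕ}

theorem lintegral_card_shortEdges_sq_le (R : ℝ) :
    ∫⁻ x, ((shortEdges x R).card : ℝ≥0∞) ^ 2 ∂(pointMeasure n d) ≤
      (n.choose 2 : ℝ≥0∞) ^ 2 * (ENNReal.ofReal (2 * R) ^ d) ^ 2 +
        n.choose 2 * ENNReal.ofReal (2 * R) ^ d := by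
  classical
  set p := ENNReal.ofReal (2 * R) ^ d
  have hN : Fintype.card (Simplex n 1) = n.choose 2 := by simp
  have hcard : ∀ x : Fin n → EuclideanSpace ℝ (Fin d), ((shortEdges x R).card : ℝ≥0∞) ^ 2 =
      ∑ e, ∑ f, (shortEvent d R e ∩ shortEvent d R f).indicator 1 x := fun x => by
    rw [shortEdges, Finset.card_filter, Nat.cast_sum, sq, Finset.sum_mul_sum]
    refine Finset.sum_congr rfl fun e _ => Finset.sum_congr rfl fun f _ => ?_
    by_cases he : edgeLength x e ≤ R <;> by_cases hf : edgeLength x f ≤ R <;>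
      simp [shortEvent, he, hf]
  have hmeas : ∀ e f : Simplex n 1, MeasurableSet (shortEvent d R e ∩ shortEvent d R f) :=
    fun e f => (measurableSet_shortEvent R e).inter (measurableSet_shortEvent R f)
  have hpair : ∀ e f : Simplex n 1, pointMeasure n d (shortEvent d R e ∩ shortEvent d R f) ≤
      p ^ 2 + if e = f then p else 0 := by
    intro e f
    by_cases hef : e = f
    · subst hef
      rw [Set.inter_self, if_pos rfl]
      exact (measure_shortEvent_le R e).trans le_add_self
    · rw [if_neg hef, add_zero]
      exact measure_shortEvent_inter_le R hef
  simp only [hcard]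
  rw [lintegral_finsetSum _ fun e _ => Finset.measurable_sum _ fun f _ =>
    measurable_one.indicator (hmeas e f)]
  calc ∑ e, ∫⁻ x, ∑ f, (shortEvent d R e ∩ shortEvent d R f).indicator 1 x ∂(pointMeasure n d)
      = ∑ e : Simplex n 1, ∑ f, pointMeasure n d (shortEvent d R e ∩ shortEvent d R f) := by
        refine Finset.sum_congr rfl fun e _ => ?_
        rw [lintegral_finsetSum _ fun f _ => measurable_one.indicator (hmeas e f)]
        exact Finset.sum_congr rfl fun f _ => lintegral_indicator_one (hmeas e f)
    _ ≤ ∑ e : Simplex n 1, ∑ f, (p ^ 2 + if e = f then p else 0) :=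
        Finset.sum_le_sum fun e _ => Finset.sum_le_sum fun f _ => hpair e f
    _ = _ := by
        simp only [Finset.sum_add_distrib, Finset.sum_const, Finset.card_univ, hN,
          Finset.sum_ite_eq, Finset.mem_univ, if_true, nsmul_eq_mul]
        ring

/-- For points in the cube, either the deterministic bound with threshold `R` applies, or two
points at distance more than `R` have no other point in the ball between them, in which case the
trivial bound is used. -/
theorem IsVietorisRipsOrder.fillUp_le_add_indicator {x : Fin n → EuclideanSpace ℝ (Fin d)}
    {σ : SimplexOrder n 1} {τ : SimplexOrder n 2} (h : IsVietorisRipsOrder x σ τ)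
    (hx : ∀ a, x a ∈ unitCube d) (R : ℝ) :
    (fillUp (boundaryMatrix σ τ) : ℝ≥0∞) ≤
      3 * n.choose 2 + ((shortEdges x R).card : ℝ≥0∞) ^ 2 +
        (n.choose 2 : ℝ≥0∞) ^ 2 * ∑ a, ∑ b, (emptyBallEvent d R a b {a, b}ᶜ).indicator 1 x := by
  classical
  by_cases hbad : ∃ a b, x ∈ emptyBallEvent d R a b {a, b}ᶜ
  · obtain ⟨a, b, hab⟩ := hbad
    have h1 : (1 : ℝ≥0∞) ≤ ∑ a, ∑ b, (emptyBallEvent d R a b {a, b}ᶜ).indicator 1 x := by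
      have h2 : (emptyBallEvent d R a b {a, b}ᶜ).indicator
          (1 : (Fin n → EuclideanSpace ℝ (Fin d)) → ℝ≥0∞) x = 1 := Set.indicator_of_mem hab _
      rw [← h2]
      refine (Finset.single_le_sum (f := fun b => (emptyBallEvent d R a b {a, b}ᶜ).indicator
        (1 : (Fin n → EuclideanSpace ℝ (Fin d)) → ℝ≥0∞) x)
        (fun _ _ => zero_le) (Finset.mem_univ b)).trans ?_
      exact Finset.single_le_sum (f := fun a => ∑ b, (emptyBallEvent d R a b {a, b}ᶜ).indicator
        (1 : (Fin n → EuclideanSpace ℝ (Fin d)) → ℝ≥0∞) x) (fun _ _ => zero_le) (Finset.mem_univ a)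
    have h3 : (fillUp (boundaryMatrix σ τ) : ℝ≥0∞) ≤ (n.choose 2 : ℝ≥0∞) ^ 2 := by
      exact_mod_cast fillUp_le_sq (boundaryMatrix σ τ)
    calc (fillUp (boundaryMatrix σ τ) : ℝ≥0∞) ≤ (n.choose 2 : ℝ≥0∞) ^ 2 * 1 := by rwa [mul_one]
      _ ≤ _ := (mul_le_mul_right h1 _).trans le_add_self
  · push Not at hbad
    refine le_trans ?_ le_self_add
    have h4 : fillUp (boundaryMatrix σ τ) ≤ 3 * n.choose 2 + (shortEdges x R).card ^ 2 := by
      refine h.fillUp_le fun a b hab hlt => ?_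
      by_contra! hc
      refine hbad a b ⟨⟨hx a, hx b, hlt⟩, fun c hcs => ?_⟩
      simp only [Finset.mem_compl, Finset.mem_insert, Finset.mem_singleton, not_or] at hcs
      by_contra! hball
      have hd : ∀ u v : EuclideanSpace ℝ (Fin d),
          dist u ((2⁻¹ : ℝ) • (u + v)) = dist u v / 2 := fun u v => by
        rw [dist_eq_norm, dist_eq_norm,
          show u - (2⁻¹ : ℝ) • (u + v) = (2⁻¹ : ℝ) • (u - v) by module, norm_smul]
        norm_num
        ring
      have ha : dist (x a) (x c) < dist (x a) (x b) := by
        have := dist_triangle_right (x a) (x c) ((2⁻¹ : ℝ) • (x a + x b))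
        rw [hd] at this
        linarith
      have hb : dist (x b) (x c) < dist (x a) (x b) := by
        have := dist_triangle_right (x b) (x c) ((2⁻¹ : ℝ) • (x a + x b))
        rw [add_comm (x a) (x b), hd, dist_comm (x b) (x a), add_comm (x b) (x a)] at this
        linarith
      exact absurd hb (not_lt.2 (hc c hcs.1 hcs.2 ha))
    exact_mod_cast h4

/-- The sum runs over all ordered pairs; the event is empty for `a = b`, since `R` is
non-negative. -/
theorem sum_measure_emptyBallEvent_le (hd : 1 ≤ d) {R : ℝ} (hR : 0 ≤ R) :
    ∑ a : Fin n, ∑ b, pointMeasure n d (emptyBallEvent d R a b {a, b}ᶜ) ≤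
      (n : ℝ≥0∞) ^ 2 * ENNReal.ofReal (Real.exp (-(R / (4 * d)) ^ d)) ^ (n - 2) := by
  classical
  set q := ENNReal.ofReal (Real.exp (-(R / (4 * d)) ^ d))
  have h : ∀ a b : Fin n, pointMeasure n d (emptyBallEvent d R a b {a, b}ᶜ) ≤ q ^ (n - 2) := by
    intro a b
    by_cases hab : a = b
    · have hempty : emptyBallEvent d R a b {a, b}ᶜ = ∅ := by
        ext x
        simp [emptyBallEvent, hab, not_lt.2 hR]
      rw [hempty, measure_empty]
      exact zero_le
    · refine (measure_emptyBallEvent_le hd hR _ (by simp) (by simp)).trans_eq ?_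
      rw [Finset.card_compl, Finset.card_pair hab, Fintype.card_fin]
  refine (Finset.sum_le_sum fun a _ => Finset.sum_le_sum fun b _ => h a b).trans_eq ?_
  simp only [Finset.sum_const, Finset.card_univ, Fintype.card_fin, nsmul_eq_mul]
  ring

variable {Ω : Type*} [MeasurableSpace Ω] {μ : Measure Ω}
  {X : Fin n → Ω → EuclideanSpace ℝ (Fin d)} {σ : Ω → SimplexOrder n 1} {τ : Ω → SimplexOrder n 2}

theorem IsVietorisRipsModel.map_eq [IsProbabilityMeasure μ] (h : IsVietorisRipsModel μ X σ τ) :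
    μ.map (fun ω a => X a ω) = pointMeasure n d := by
  rw [(iIndepFun_iff_map_fun_eq_pi_map fun a => (h.measurable_point a).aemeasurable).1 h.indep]
  exact congrArg Measure.pi (funext fun a => h.uniform a)

theorem IsVietorisRipsModel.ae_mem_unitCube (h : IsVietorisRipsModel μ X σ τ) :
    ∀ᵐ ω ∂μ, ∀ a, X a ω ∈ unitCube d := by
  refine ae_all_iff.2 fun a => ?_
  refine ae_of_ae_map (h.measurable_point a).aemeasurable (p := fun y => y ∈ unitCube d) ?_
  rw [show μ.map (X a) = ProbabilityTheory.cond volume (unitCube d) from h.uniform a]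
  exact ae_cond_mem measurableSet_unitCube

theorem IsVietorisRipsModel.lintegral_fillUp_le [IsProbabilityMeasure μ]
    (h : IsVietorisRipsModel μ X σ τ) (hd : 1 ≤ d) {R : ℝ} (hR : 0 ≤ R) :
    ∫⁻ ω, (fillUp (boundaryMatrix (σ ω) (τ ω)) : ℝ≥0∞) ∂μ ≤
      3 * n.choose 2 + ((n.choose 2 : ℝ≥0∞) ^ 2 * (ENNReal.ofReal (2 * R) ^ d) ^ 2 +
        n.choose 2 * ENNReal.ofReal (2 * R) ^ d) + (n.choose 2 : ℝ≥0∞) ^ 2 *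
        ((n : ℝ≥0∞) ^ 2 * ENNReal.ofReal (Real.exp (-(R / (4 * d)) ^ d)) ^ (n - 2)) := by
  classical
  have hX : Measurable fun ω a => X a ω := measurable_pi_lambda _ h.measurable_point
  have hind : ∀ a b : Fin n, Measurable
      ((emptyBallEvent d R a b {a, b}ᶜ).indicator
        (1 : (Fin n → EuclideanSpace ℝ (Fin d)) → ℝ≥0∞)) :=
    fun a b => measurable_one.indicator (measurableSet_emptyBallEvent R a b _)
  have hind2 : Measurable fun x : Fin n → EuclideanSpace ℝ (Fin d) =>
      ∑ a, ∑ b, (emptyBallEvent d R a b {a, b}ᶜ).indicator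
        (1 : (Fin n → EuclideanSpace ℝ (Fin d)) → ℝ≥0∞) x :=
    Finset.measurable_sum _ fun a _ => Finset.measurable_sum _ fun b _ => hind a b
  have hshort : Measurable fun x : Fin n → EuclideanSpace ℝ (Fin d) =>
      ((shortEdges x R).card : ℝ≥0∞) := by
    simp only [shortEdges, Finset.card_filter, Nat.cast_sum, Nat.cast_ite, Nat.cast_one,
      Nat.cast_zero]
    exact Finset.measurable_sum _ fun e _ =>
      Measurable.ite (measurableSet_shortEvent R e) measurable_const measurable_const
  set g : (Fin n → EuclideanSpace ℝ (Fin d)) → ℝ≥0∞ := fun x => 3 * (n.choose 2 : ℝ≥0∞) +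
    ((shortEdges x R).card : ℝ≥0∞) ^ 2 + (n.choose 2 : ℝ≥0∞) ^ 2 *
      ∑ a, ∑ b, (emptyBallEvent d R a b {a, b}ᶜ).indicator 1 x with hg
  have hae : ∀ᵐ ω ∂μ, (fillUp (boundaryMatrix (σ ω) (τ ω)) : ℝ≥0∞) ≤ g fun a => X a ω := by
    filter_upwards [h.filtration, h.ae_mem_unitCube] with ω h1 h2
    exact h1.fillUp_le_add_indicator h2 R
  refine (lintegral_mono_ae hae).trans ?_
  rw [← lintegral_map (f := g)
    ((measurable_const.add (hshort.pow_const 2)).add (hind2.const_mul _)) hX, h.map_eq, hg,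
    lintegral_add_right _ (hind2.const_mul _), lintegral_add_right _ (hshort.pow_const 2),
    lintegral_const_mul _ hind2, lintegral_const, measure_univ, mul_one]
  refine add_le_add (add_le_add_right (lintegral_card_shortEdges_sq_le R) _)
    (mul_le_mul_right ?_ _)
  refine le_trans (le_of_eq ?_) (sum_measure_emptyBallEvent_le hd hR)
  rw [lintegral_finsetSum _ fun a _ => Finset.measurable_sum _ fun b _ => hind a b]
  refine Finset.sum_congr rfl fun a _ => ?_
  rw [lintegral_finsetSum _ fun b _ => hind a b]
  exact Finset.sum_congr rfl fun b _ =>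
    lintegral_indicator_one (measurableSet_emptyBallEvent R a b _)

/-- A function of the two orders takes finitely many values, so it is integrable. -/
theorem IsVietorisRipsModel.integrable [IsProbabilityMeasure μ] (h : IsVietorisRipsModel μ X σ τ)
    (F : SimplexOrder n 1 → SimplexOrder n 2 → ℝ) : Integrable (fun ω => F (σ ω) (τ ω)) μ := by
  classical
  have hmeas : Measurable fun ω => F (σ ω) (τ ω) := by
    intro s _
    have hset : (fun ω => F (σ ω) (τ ω)) ⁻¹' s =
        ⋃ a : SimplexOrder n 1, σ ⁻¹' {a} ∩ τ ⁻¹' {b | F a b ∈ s} := by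
      ext ω
      simp
    rw [hset]
    exact MeasurableSet.iUnion fun a =>
      (h.measurable_edgeOrder trivial).inter (h.measurable_triangleOrder trivial)
  refine Integrable.of_bound hmeas.aestronglyMeasurable (∑ a, ∑ b, ‖F a b‖)
    (Filter.Eventually.of_forall fun ω => ?_)
  refine (Finset.single_le_sum (f := fun b => ‖F (σ ω) b‖) (fun _ _ => norm_nonneg _)
    (Finset.mem_univ (τ ω))).trans ?_
  exact Finset.single_le_sum (f := fun a => ∑ b, ‖F a b‖)
    (fun _ _ => Finset.sum_nonneg fun _ _ => norm_nonneg _) (Finset.mem_univ (σ ω))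

theorem IsVietorisRipsModel.integral_fillUp_le [IsProbabilityMeasure μ]
    (h : IsVietorisRipsModel μ X σ τ) (hd : 1 ≤ d) {R : ℝ} (hR : 0 ≤ R) :
    ∫ ω, (fillUp (boundaryMatrix (σ ω) (τ ω)) : ℝ) ∂μ ≤
      3 * n.choose 2 + ((n.choose 2 : ℝ) ^ 2 * ((2 * R) ^ d) ^ 2 +
        n.choose 2 * (2 * R) ^ d) + (n.choose 2 : ℝ) ^ 2 *
        ((n : ℝ) ^ 2 * Real.exp (-(R / (4 * d)) ^ d) ^ (n - 2)) := by
  rw [← ENNReal.ofReal_le_ofReal_iff (by positivity), ofReal_integral_eq_lintegral_ofReal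
    (h.integrable fun a b => (fillUp (boundaryMatrix a b) : ℝ))
    (Filter.Eventually.of_forall fun _ => Nat.cast_nonneg _)]
  simp only [ENNReal.ofReal_natCast]
  refine (h.lintegral_fillUp_le hd hR).trans_eq ?_
  have e1 : ENNReal.ofReal (3 : ℝ) = 3 := by simp
  have hR2 : 0 ≤ 2 * R := by positivity
  have hexp : 0 ≤ Real.exp (-(R / (4 * d)) ^ d) := (Real.exp_pos _).le
  generalize 2 * R = P at hR2 ⊢
  generalize Real.exp (-(R / (4 * d)) ^ d) = Q at hexp ⊢
  rw [ENNReal.ofReal_add (by positivity) (by positivity),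
    ENNReal.ofReal_add (by positivity) (by positivity),
    ENNReal.ofReal_add (by positivity) (by positivity),
    ENNReal.ofReal_mul (by norm_num), ENNReal.ofReal_mul (by positivity),
    ENNReal.ofReal_mul (by positivity), ENNReal.ofReal_mul (by positivity),
    ENNReal.ofReal_mul (by positivity), ENNReal.ofReal_pow (by positivity),
    ENNReal.ofReal_pow (by positivity), ENNReal.ofReal_pow hR2,
    ENNReal.ofReal_pow (by positivity), ENNReal.ofReal_pow hexp, e1]
  simp only [ENNReal.ofReal_natCast]

/-- The threshold `R` is chosen with `(R / (4 d)) ^ d = 12 log n / n`: the probability that a pair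
at distance more than `R` has an empty ball is then at most `n ^ (-4)`, while about
`n ^ 2 * R ^ d`, that is `n log n`, edges are shorter than `R`. -/
theorem IsVietorisRipsModel.integral_fillUp_le_log [IsProbabilityMeasure μ]
    (h : IsVietorisRipsModel μ X σ τ) (hd : 1 ≤ d) :
    ∫ ω, (fillUp (boundaryMatrix (σ ω) (τ ω)) : ℝ) ∂μ ≤
      (4 + 12 * (8 * (d : ℝ)) ^ d + (12 * (8 * (d : ℝ)) ^ d) ^ 2) *
        ((n : ℝ) ^ 2 * Real.log n ^ 2) := by
  -- without triangles there is no column, and `log n` may vanish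
  rcases le_or_gt n 2 with hn | hn
  · simp only [fillUp_eq_zero_of_le_two hn, Nat.cast_zero, integral_zero]
    positivity
  have hn3 : (3 : ℝ) ≤ n := by exact_mod_cast hn
  have hn0 : (0 : ℝ) < n := by linarith
  have hd0 : (0 : ℝ) < d := by exact_mod_cast hd
  set L := Real.log n with hL
  have hL1 : 1 ≤ L := by
    rw [hL, Real.le_log_iff_exp_le hn0]
    linarith [Real.exp_one_lt_d9]
  set t := 12 * L / n with ht
  have ht0 : 0 ≤ t := by positivity
  set K := 12 * (8 * (d : ℝ)) ^ d with hK
  have hK0 : 0 ≤ K := by positivity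
  have hroot : (t ^ (1 / (d : ℝ))) ^ d = t := by
    rw [one_div]
    exact Real.rpow_inv_natCast_pow ht0 (by omega)
  set R := 4 * d * t ^ (1 / (d : ℝ)) with hRdef
  have hR : 0 ≤ R := by positivity
  have hRt : (R / (4 * d)) ^ d = t := by
    rw [hRdef, mul_div_cancel_left₀ _ (by positivity), hroot]
  have hp : (2 * R) ^ d = K * (L / n) := by
    rw [hRdef, show 2 * (4 * d * t ^ (1 / (d : ℝ))) = (8 * d) * t ^ (1 / (d : ℝ)) by ring,
      mul_pow, hroot, hK, ht]
    ring
  have hq : Real.exp (-(R / (4 * d)) ^ d) ^ (n - 2) ≤ 1 / (n : ℝ) ^ 4 := by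
    rw [hRt, ← Real.exp_nat_mul, Nat.cast_sub hn.le, one_div,
      show (n : ℝ) ^ 4 = Real.exp (4 * L) by
        rw [hL, mul_comm, Real.exp_mul, Real.exp_log hn0]; norm_cast, ← Real.exp_neg]
    refine Real.exp_le_exp.2 ?_
    -- `n - 2 ≥ n / 3`, which is where the factor `12 = 3 * 4` comes from
    have h1 : 4 * L ≤ (n - 2) * t := by
      rw [ht, ← mul_div_assoc, le_div_iff₀ hn0]
      nlinarith
    push_cast
    linarith
  have hN : (n.choose 2 : ℝ) ≤ (n : ℝ) ^ 2 := by
    exact_mod_cast Nat.choose_le_pow n 2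
  have hN4 : (n.choose 2 : ℝ) ^ 2 ≤ (n : ℝ) ^ 4 := by
    calc (n.choose 2 : ℝ) ^ 2 ≤ ((n : ℝ) ^ 2) ^ 2 := by gcongr
      _ = (n : ℝ) ^ 4 := by ring
  have hLsq : 1 ≤ L ^ 2 := one_le_pow₀ hL1
  have hLL : L ≤ L ^ 2 := by nlinarith
  have hn2 : (n : ℝ) ≤ (n : ℝ) ^ 2 := by nlinarith
  refine (h.integral_fillUp_le hd hR).trans ?_
  rw [hp]
  calc 3 * (n.choose 2 : ℝ) + ((n.choose 2 : ℝ) ^ 2 * (K * (L / n)) ^ 2 +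
        n.choose 2 * (K * (L / n))) + (n.choose 2 : ℝ) ^ 2 *
        ((n : ℝ) ^ 2 * Real.exp (-(R / (4 * d)) ^ d) ^ (n - 2))
      ≤ 3 * (n : ℝ) ^ 2 + ((n : ℝ) ^ 4 * (K * (L / n)) ^ 2 +
        (n : ℝ) ^ 2 * (K * (L / n))) + (n : ℝ) ^ 4 * ((n : ℝ) ^ 2 * (1 / (n : ℝ) ^ 4)) := by
        gcongr
    _ = 4 * ((n : ℝ) ^ 2 * 1) + K * (n * L) + K ^ 2 * ((n : ℝ) ^ 2 * L ^ 2) := by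
        field_simp
        ring
    _ ≤ 4 * ((n : ℝ) ^ 2 * L ^ 2) + K * ((n : ℝ) ^ 2 * L ^ 2) +
        K ^ 2 * ((n : ℝ) ^ 2 * L ^ 2) := by gcongr
    _ = _ := by ring

end Expectation

theorem mainTheorem2 :
    ∃ c : ℝ, 0 < c ∧
      -- the deterministic lower bound, for arbitrary orders of the edges and the triangles
      (∀ (n : ℕ) (σ : SimplexOrder n 1) (τ : SimplexOrder n 2),
        (n.choose 2 : ℝ) - (n : ℝ) ≤ (fillUp (boundaryMatrix σ τ) : ℝ) ∧
        (3 ≤ n → c * (n : ℝ) ^ 2 ≤ (fillUp (boundaryMatrix σ τ) : ℝ))) ∧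
      -- the Vietoris–Rips model
      ∀ d : ℕ, 1 ≤ d → ∃ C : ℝ, 0 < C ∧
        ∀ (n : ℕ) {Ω : Type*} [MeasurableSpace Ω] (μ : Measure Ω) [IsProbabilityMeasure μ]
          (X : Fin n → Ω → EuclideanSpace ℝ (Fin d))
          (σ : Ω → SimplexOrder n 1) (τ : Ω → SimplexOrder n 2),
          IsVietorisRipsModel μ X σ τ →
          Integrable (fun ω => (fillUp (boundaryMatrix (σ ω) (τ ω)) : ℝ)) μ ∧
          (∫ ω, (fillUp (boundaryMatrix (σ ω) (τ ω)) : ℝ) ∂μ)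
            ≤ C * ((n : ℝ) ^ 2 * Real.log n ^ 2) ∧
          (3 ≤ n → c * (n : ℝ) ^ 2 ≤ ∫ ω, (fillUp (boundaryMatrix (σ ω) (τ ω)) : ℝ) ∂μ) ∧
          Integrable (fun ω => (reductionCost (boundaryMatrix (σ ω) (τ ω)) : ℝ)) μ ∧
          (∫ ω, (reductionCost (boundaryMatrix (σ ω) (τ ω)) : ℝ) ∂μ)
            ≤ C * ((n : ℝ) ^ 5 * Real.log n ^ 2) := by
  -- `(n - 1) * (n - 2) / 2 ≥ n ^ 2 / 9` for `n ≥ 3`, with equality at `n = 3`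
  refine ⟨1 / 9, by norm_num, fun n σ τ => ⟨choose_two_sub_le_fillUp σ τ,
    fun hn => sq_le_fillUp hn σ τ⟩, fun d hd =>
    ⟨4 + 12 * (8 * (d : ℝ)) ^ d + (12 * (8 * (d : ℝ)) ^ d) ^ 2, by positivity, ?_⟩⟩
  intro n Ω _ μ _ X σ τ h
  have hint := h.integrable fun a b => (fillUp (boundaryMatrix a b) : ℝ)
  have hcint := h.integrable fun a b => (reductionCost (boundaryMatrix a b) : ℝ)
  have hfill := h.integral_fillUp_le_log hd
  refine ⟨hint, hfill, fun hn => ?_, hcint, ?_⟩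
  · calc (1 / 9 : ℝ) * (n : ℝ) ^ 2 = ∫ _ω, (1 / 9 : ℝ) * (n : ℝ) ^ 2 ∂μ := by simp
      _ ≤ _ := integral_mono (integrable_const _) hint fun ω => sq_le_fillUp hn _ _
  · have hcost : ∀ ω, (reductionCost (boundaryMatrix (σ ω) (τ ω)) : ℝ) ≤
        (n : ℝ) ^ 3 * fillUp (boundaryMatrix (σ ω) (τ ω)) := fun ω => by
      have h1 := (reductionCost_le (boundaryMatrix (σ ω) (τ ω))).trans
        (Nat.mul_le_mul_right _ (Nat.choose_le_pow n 3))
      calc (reductionCost (boundaryMatrix (σ ω) (τ ω)) : ℝ) ≤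
          ((n ^ 3 * fillUp (boundaryMatrix (σ ω) (τ ω)) : ℕ) : ℝ) := Nat.cast_le.2 h1
        _ = _ := by rw [Nat.cast_mul, Nat.cast_pow]
    calc ∫ ω, (reductionCost (boundaryMatrix (σ ω) (τ ω)) : ℝ) ∂μ
        ≤ ∫ ω, (n : ℝ) ^ 3 * fillUp (boundaryMatrix (σ ω) (τ ω)) ∂μ :=
          integral_mono hcint (hint.const_mul _) hcost
      _ = (n : ℝ) ^ 3 * ∫ ω, (fillUp (boundaryMatrix (σ ω) (τ ω)) : ℝ) ∂μ :=
          integral_const_mul _ _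
      _ ≤ (n : ℝ) ^ 3 * _ := mul_le_mul_of_nonneg_left hfill (by positivity)
      _ = _ := by ring
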